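/- Let $T$ be a bounded self-adjoint operator on a complex Hilbert space $\mathcal H$. For a real number $t$, say that $T$ is a pencil at $t$ if $T=tP+Q$ for some nonzero orthogonal projections $P,Q$ on $\mathcal H$. Write $\sigma(T)$ for the spectrum of $T$, $\mathcal N(\cdot)$ for the null space, and $\dim$ for the Hilbert space dimension (the cardinality of an orthonormal basis). For $z\in\mathbb R$ let $(\ast_z)$ be the condition $$\{z,1+z\}\subseteq\sigma(T)\subseteq\{0,1,z,1+z\}\quad\text{and}\quad \dim\mathcal N(T-(1+z)I)=\dim\mathcal N(T-zI).$$ (1) There are nonzero real numbers $\lambda,\mu$ with $\max\{\lambda,\mu\}=2\min\{\lambda,\mu\}\neq 2$ such that $T$ is a pencil at $\lambda$ and a pencil at $\mu$ if and only if $(\ast_z)$ holds for some $z\in(0,1)$. (2) There are nonzero real numbers $\lambda,\mu$ with $\min\{\lambda,\mu\}=2\max\{\lambda,\mu\}\neq -2$ such that $T$ is a pencil at $\lambda$ and a pencil at $\mu$ if and only if $(\ast_z)$ holds for some $z\in(-1,0)$. (3) If $(\ast_z)$ holds for some $z\in(0,1)\cup(-1,0)$, then there are exactly two real numbers at which $T$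 is a pencil, namely $z$ and $2z$. -/

import Mathlib

open scoped InnerProductSpace

universe u

/-- The pencil of a pair `(P, Q)` of bounded operators: the function `t ↦ t P + Q` on `ℝ`. -/
def pencil {H : Type*} [NormedAddCommGroup H] [InnerProductSpace ℂ H]
    (P Q : H →L[ℂ] H) (t : ℝ) : H →L[ℂ] H :=
  (t : ℂ) • P + Q

/-- `T` is the pencil, at the real number `t`, of some pair of nonzero orthogonal projections. -/
def IsPencilAt {H : Type*} [NormedAddCommGroup H] [InnerProductSpace ℂ H] [CompleteSpace H]
    (T : H →L[ℂ] H) (t : ℝ) : Prop :=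
  ∃ P Q : H →L[ℂ] H, IsStarProjection P ∧ IsStarProjection Q ∧ P ≠ 0 ∧ Q ≠ 0 ∧
    T = pencil P Q t

/-- The Hilbert dimension of a Hilbert space: the cardinality of its orthonormal bases.  It is
written as the least such cardinality; `hilbertDim_eq` shows that all of them are equal. -/
noncomputable def hilbertDim (E : Type u) [NormedAddCommGroup E] [InnerProductSpace ℂ E] :
    Cardinal.{u} :=
  sInf {c : Cardinal.{u} | ∃ ι : Type u, Nonempty (HilbertBasis ι ℂ E) ∧ Cardinal.mk ι = c}

theorem hilbertBasis_mk_le {E ι κ : Type u} [NormedAddCommGroup E] [InnerProductSpace ℂ E]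
    (b : HilbertBasis ι ℂ E) (c : HilbertBasis κ ℂ E) : Cardinal.mk κ ≤ Cardinal.mk ι := by
  rcases finite_or_infinite ι with hι | hι
  · have := Fintype.ofFinite ι
    have h1 := c.orthonormal.linearIndependent.cardinal_le_rank
    rwa [← b.toOrthonormalBasis.toBasis.mk_eq_rank''] at h1
  · have hcount : ∀ i, (Set.Countable {j | ⟪b i, c j⟫_ℂ ≠ 0}) := fun i =>
      ((c.hasSum_inner_mul_inner (b i) (b i)).summable.countable_support).mono (by
        intro j hj
        simp only [Function.mem_support, ne_eq, mul_eq_zero, not_or]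
        exact ⟨hj, fun h => hj (by rw [← inner_conj_symm, h, map_zero])⟩)
    have hcov : (⋃ i, {j | ⟪b i, c j⟫_ℂ ≠ 0}) = Set.univ := by
      refine Set.eq_univ_of_forall fun j => ?_
      by_contra hj
      simp only [Set.mem_iUnion, Set.mem_ofPred_eq, not_exists, not_not] at hj
      have h0 : c j = 0 := by
        apply b.repr.injective
        ext i
        simp [b.repr_apply_apply, hj i]
      exact c.orthonormal.ne_zero j h0
    calc Cardinal.mk κ = Cardinal.mk (Set.univ : Set κ) := Cardinal.mk_univ.symm
      _ = Cardinal.mk (⋃ i, {j | ⟪b i, c j⟫_ℂ ≠ 0} : Set κ) := by rw [hcov]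
      _ ≤ Cardinal.mk ι * ⨆ i, Cardinal.mk {j | ⟪b i, c j⟫_ℂ ≠ 0} := Cardinal.mk_iUnion_le _
      _ ≤ Cardinal.mk ι * Cardinal.aleph0 := by
        gcongr
        exact ciSup_le' fun i => (hcount i).le_aleph0
      _ = Cardinal.mk ι := Cardinal.mul_aleph0_eq (Cardinal.aleph0_le_mk ι)

theorem hilbertDim_eq {E ι : Type u} [NormedAddCommGroup E] [InnerProductSpace ℂ E]
    (b : HilbertBasis ι ℂ E) : hilbertDim E = Cardinal.mk ι := by
  have hne : {c : Cardinal.{u} | ∃ ι : Type u, Nonempty (HilbertBasis ι ℂ E) ∧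
      Cardinal.mk ι = c}.Nonempty := ⟨_, ι, ⟨b⟩, rfl⟩
  obtain ⟨κ, ⟨c⟩, hc⟩ := csInf_mem hne
  exact hc.symm.trans (le_antisymm (hilbertBasis_mk_le b c) (hilbertBasis_mk_le c b))

/-- `{z, 1 + z} ⊆ σ(T) ⊆ {0, 1, z, 1 + z}` and `dim N(T - (1 + z) I) = dim N(T - z I)`. -/
def HasShiftedSpectrum {H : Type*} [NormedAddCommGroup H] [InnerProductSpace ℂ H]
    (T : H →L[ℂ] H) (z : ℝ) : Prop :=
  {1 + (z : ℂ), (z : ℂ)} ⊆ spectrum ℂ T ∧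
  spectrum ℂ T ⊆ {0, 1, 1 + (z : ℂ), (z : ℂ)} ∧
  hilbertDim (T - (1 + (z : ℂ)) • (1 : H →L[ℂ] H)).ker =
    hilbertDim (T - (z : ℂ) • (1 : H →L[ℂ] H)).ker

/-! Everything rests on the commutator `K = Q * P - P * Q`. For `T = t P + Q` it satisfies `T K = K
(1 + t - T)`, and the quartic `f_t(x) = x (1 + t - x) (x - 1) (x - t)` gives `f_t(T) = -t² K²`,
which equals `t² K* K ≥ 0` for orthogonal projections. Hence `f_t ≥ 0` on `σ(T)`; off the zeros of
`f_t` the spectrum is invariant under `x ↦ 1 + t - x` (`pencil_spectrum_symm`); and where `f_t(x) >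
0` a multiple of `K` maps the eigenspace at `x` isometrically onto the one at `1 + t - x`
(`hilbertDim_ker_pencil_symm`).

If `T` is a pencil at `t > 0` and at `2t`, with `t ≠ 1`, playing the two reflections against the
bounds `0 ≤ T ≤ 1 + t` leaves only the points `0, 1, t, 1 + t` (`spectrum_subset_of_pencil_pencil`).
A spectrum inside `{0, 1}` would make `T` idempotent and force `P = 0`. So `t < 1` and one of `t, 1
+ t` is in the spectrum; the reflection of the second pencil exchanges these two points and matches
their eigenspaces.

Conversely, let `a, b, c` be the spectral projections at `z, 1 + z, 1`, so that `T = z a + (1 + z) b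
+ c`. Then `T = z (a + b) + (b + c)`, and equal dimensions give a partial isometry from `a` to `b`,
hence `2 × 2` block projections realizing `T` at `2z` (`exists_pencil_two_mul`). Reflecting the
point `z` shows that no other parameter occurs (`eq_or_eq_two_mul_of_pencil`). Negative parameters
follow by passing from `T` to `1 - T`. -/

/-! ### Algebraic identities for two idempotents. -/

section Algebra

variable {A : Type*} [Ring A] [Algebra ℝ A] {P Q T : A} {t : ℝ}

/-- The right-hand side is `t (P - Q)²`. -/
theorem pencil_mul_sub_self (hP : IsIdempotentElem P) (hQ : IsIdempotentElem Q)
    (h : T = t • P + Q) :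
    T * ((1 + t) • 1 - T) = t • (P + Q - P * Q - Q * P) := by
  have hP' : P * P = P := hP
  have hQ' : Q * Q = Q := hQ
  subst h
  simp only [mul_sub, add_mul, mul_add, smul_mul_assoc, mul_smul_comm, mul_one, hP', hQ']
  module

/-- With `K = Q * P - P * Q` one has `P K = K (1 - P)` and `Q K = K (1 - Q)`: the commutator
exchanges each idempotent with its complement. -/
theorem pencil_mul_commutator (hP : IsIdempotentElem P) (hQ : IsIdempotentElem Q)
    (h : T = t • P + Q) :
    T * (Q * P - P * Q) = (Q * P - P * Q) * ((1 + t) • 1 - T) := by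
  have hP' : P * P = P := hP
  have hQ' : Q * Q = Q := hQ
  have hP2 : ∀ x, P * (P * x) = P * x := fun x => by rw [← mul_assoc, hP']
  have hQ2 : ∀ x, Q * (Q * x) = Q * x := fun x => by rw [← mul_assoc, hQ']
  subst h
  simp only [mul_sub, sub_mul, add_mul, mul_add, smul_mul_assoc, mul_smul_comm, mul_one,
    mul_assoc, hP', hQ', hP2, hQ2]
  module

theorem commutator_mul_pencil (hP : IsIdempotentElem P) (hQ : IsIdempotentElem Q)
    (h : T = t • P + Q) :
    (Q * P - P * Q) * T = ((1 + t) • 1 - T) * (Q * P - P * Q) := by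
  have := pencil_mul_commutator hP hQ h
  simp only [mul_sub _ ((1 + t) • (1 : A)), sub_mul ((1 + t) • (1 : A)), smul_mul_assoc,
    mul_smul_comm, mul_one, one_mul] at this ⊢
  rw [this, sub_sub_cancel]

/-- The quartic whose value at the pencil `t P + Q` is `- t ^ 2 [Q, P] ^ 2`. -/
noncomputable def pencilQuartic (t : ℝ) : Polynomial ℝ :=
  .X * (.C (1 + t) - .X) * (.X - 1) * (.X - .C t)

theorem eval_pencilQuartic (t x : ℝ) :
    (pencilQuartic t).eval x = x * (1 + t - x) * (x - 1) * (x - t) := by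
  simp [pencilQuartic]

/-- With `S = (P - Q)²`, the factors pair up as `T (1 + t - T) = t S` and `(T - 1) (T - t) = t (1 -
S)`, while `S - S² = -K²`. -/
theorem aeval_pencilQuartic (hP : IsIdempotentElem P) (hQ : IsIdempotentElem Q)
    (h : T = t • P + Q) :
    Polynomial.aeval T (pencilQuartic t) =
      -(t ^ 2 • ((Q * P - P * Q) * (Q * P - P * Q))) := by
  have hP' : P * P = P := hP
  have hQ' : Q * Q = Q := hQ
  have hP2 : ∀ x, P * (P * x) = P * x := fun x => by rw [← mul_assoc, hP']
  have hQ2 : ∀ x, Q * (Q * x) = Q * x := fun x => by rw [← mul_assoc, hQ']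
  have h1 := pencil_mul_sub_self hP hQ h
  have h2 : (T - 1) * (T - t • 1) = t • (1 - (P + Q - P * Q - Q * P)) := by
    rw [smul_sub, ← h1]
    simp only [mul_sub, sub_mul, mul_smul_comm, mul_one, one_mul]
    module
  simp only [pencilQuartic, map_mul, map_sub, Polynomial.aeval_X, Polynomial.aeval_C, map_one,
    Algebra.algebraMap_eq_smul_one]
  rw [h1, mul_assoc, h2]
  simp only [mul_sub, sub_mul, add_mul, mul_add, smul_mul_assoc, mul_smul_comm, mul_one,
    mul_assoc, hP', hQ', hP2, hQ2]
  module

theorem isUnit_of_mul_eq_smul_one {a b : A} {r : ℝ} (hr : r ≠ 0) (h1 : a * b = r • 1)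
    (h2 : b * a = r • 1) : IsUnit a :=
  ⟨⟨a, r⁻¹ • b, by rw [mul_smul_comm, h1, inv_smul_smul₀ hr],
    by rw [smul_mul_assoc, h2, inv_smul_smul₀ hr]⟩, rfl⟩

/-- Away from the four exceptional points, the spectrum of `t P + Q` is symmetric about
`(1 + t) / 2`. -/
theorem pencil_spectrum_symm (hP : IsIdempotentElem P) (hQ : IsIdempotentElem Q)
    (h : T = t • P + Q) {x : ℝ} (hx : x ∈ spectrum ℝ T) (hx0 : (pencilQuartic t).eval x ≠ 0) :
    1 + t - x ∈ spectrum ℝ T := by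
  by_contra hcon
  rw [spectrum.notMem_iff] at hcon
  refine hx ?_
  obtain ⟨u, hu⟩ := hcon
  set K := Q * P - P * Q with hK
  obtain ⟨g, hg⟩ := Polynomial.X_sub_C_dvd_sub_C_eval (a := x) (p := pencilQuartic t)
  have hf := aeval_pencilQuartic hP hQ h
  have hgT := congrArg (Polynomial.aeval T) hg
  simp only [map_sub, map_mul, Polynomial.aeval_X, Polynomial.aeval_C, hf, ← hK] at hgT
  have hcomm : (T - algebraMap ℝ A x) * Polynomial.aeval T g =
      Polynomial.aeval T g * (T - algebraMap ℝ A x) := by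
    have := congrArg (Polynomial.aeval T) (mul_comm (Polynomial.X - Polynomial.C x) g)
    simpa only [map_mul, map_sub, Polynomial.aeval_X, Polynomial.aeval_C] using this
  have e1 : (T - algebraMap ℝ A x) * K = K * u := by
    rw [sub_mul, pencil_mul_commutator hP hQ h, hu]
    simp only [Algebra.algebraMap_eq_smul_one, mul_sub, smul_mul_assoc, mul_smul_comm, mul_one,
      one_mul, hK]
    module
  have e2 : K * (T - algebraMap ℝ A x) = u * K := by
    rw [mul_sub, commutator_mul_pencil hP hQ h, hu]
    simp only [Algebra.algebraMap_eq_smul_one, sub_mul, smul_mul_assoc, mul_smul_comm, mul_one,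
      one_mul, hK]
    module
  have f1 : (T - algebraMap ℝ A x) * (K * ↑u⁻¹ * K) = K * K := by
    rw [← mul_assoc, ← mul_assoc, e1, Units.mul_inv_cancel_right]
  have f2 : (K * ↑u⁻¹ * K) * (T - algebraMap ℝ A x) = K * K := by
    rw [mul_assoc, e2, mul_assoc, Units.inv_mul_cancel_left]
  rw [spectrum.mem_resolventSet_iff, ← neg_sub, IsUnit.neg_iff]
  -- Writing `f(T) - f(x) = (T - x) g(T)` and `K² = (T - x) K u⁻¹ K`, the identity `f(T) = -t² K²`
  -- becomes `(T - x) (-t² K u⁻¹ K - g(T)) = f(x)`, an explicit inverse up to the nonzero scalar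
  -- `f(x)`.
  refine isUnit_of_mul_eq_smul_one
    (b := -(t ^ 2 • (K * ↑u⁻¹ * K)) - Polynomial.aeval T g) hx0 ?_ ?_
  · rw [mul_sub, mul_neg, mul_smul_comm, f1, ← hgT, Algebra.algebraMap_eq_smul_one]
    abel
  · rw [sub_mul, neg_mul, smul_mul_assoc, f2, ← hcomm, ← hgT, Algebra.algebraMap_eq_smul_one]
    abel

/-- The points of the spectrum other than the exceptional ones come in pairs. -/
theorem pencil_spectrum_symm_of_ne (hP : IsIdempotentElem P) (hQ : IsIdempotentElem Q)
    (h : T = t • P + Q) {x : ℝ} (hx : x ∈ spectrum ℝ T) (h0 : x ≠ 0) (h1 : x ≠ 1)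
    (h2 : x ≠ t) (h3 : x ≠ 1 + t) : 1 + t - x ∈ spectrum ℝ T := by
  refine pencil_spectrum_symm hP hQ h hx ?_
  rw [eval_pencilQuartic]
  refine mul_ne_zero (mul_ne_zero (mul_ne_zero h0 ?_) (sub_ne_zero.2 h1)) (sub_ne_zero.2 h2)
  exact sub_ne_zero.2 (Ne.symm h3)

/-- An idempotent pencil `t P + Q` with `t ≠ 0, ±1` has `P = 0`. -/
theorem eq_zero_of_isIdempotentElem_pencil (hP : IsIdempotentElem P) (hQ : IsIdempotentElem Q)
    (h : T = t • P + Q) (hT : IsIdempotentElem T) (h0 : t ≠ 0) (h1 : t ≠ 1) (h2 : t ≠ -1) :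
    P = 0 := by
  have hP' : P * P = P := hP
  have hQ' : Q * Q = Q := hQ
  have hT' : T * T = T := hT
  have e : (1 - t) • P = P * Q + Q * P := by
    have := pencil_mul_sub_self hP hQ h
    rw [mul_sub, mul_smul_comm, mul_one, hT'] at this
    have h3 : t • T = t • (P + Q - P * Q - Q * P) := by rw [← this]; module
    have h4 := smul_right_injective A h0 h3
    rw [h] at h4
    have : P * Q + Q * P = P + Q - (P + Q - P * Q - Q * P) := by abel
    rw [this, ← h4]; module
  have e1 : (1 - t) • P = P * Q + P * Q * P := by
    have := congrArg (P * ·) e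
    simpa only [mul_smul_comm, hP', mul_add, ← mul_assoc] using this
  have e2 : (1 - t) • P = P * Q * P + P * Q * P := by
    have := congrArg (· * P) e1
    simpa only [smul_mul_assoc, hP', add_mul, mul_assoc] using this
  -- With `s = (1 - t) / 2`, multiplying `P Q = s P` on the right by `Q` gives `s (1 - s) P = 0`;
  -- the values `t = 1` and `t = -1` are those where `s` is `0` or `1`.
  have e3 : P * Q = ((1 - t) / 2) • P := by
    have e4 : P * Q * P = ((1 - t) / 2) • P := by
      rw [div_eq_inv_mul, mul_smul, e2]; module
    rw [e4] at e1
    rw [eq_sub_of_add_eq e1.symm]; module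
  have e4 : ((1 - t) / 2 * (1 - (1 - t) / 2)) • P = 0 := by
    have := congrArg (· * Q) e3
    simp only [smul_mul_assoc] at this
    rw [mul_assoc, hQ', e3, smul_smul] at this
    rw [mul_sub, sub_smul, mul_one, ← this, sub_self]
  refine (smul_eq_zero.1 e4).resolve_left ?_
  have : (1 - t) ≠ 0 := fun h => h1 (by linarith)
  have h' : (1 - (1 - t) / 2) ≠ 0 := fun h => h2 (by linarith)
  positivity

end Algebra

/-! ### Bounds and gaps for the real spectrum. -/

section Order

variable {A : Type*} [Ring A] [StarRing A] [PartialOrder A] [StarOrderedRing A] [Algebra ℝ A]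
  [StarModule ℝ A] {P Q T : A} {t : ℝ}

theorem IsStarProjection.smul_nonneg (hP : IsStarProjection P) (ht : 0 ≤ t) : 0 ≤ t • P := by
  have h : t • P = star (√t • P) * (√t • P) := by
    rw [star_smul, hP.isSelfAdjoint.star_eq, smul_mul_smul_comm, hP.isIdempotentElem.eq]
    simp [Real.mul_self_sqrt ht]
  rw [h]
  exact star_mul_self_nonneg _

variable [NonnegSpectrumClass ℝ A]

theorem pencil_spectrum_nonneg (hP : IsStarProjection P) (hQ : IsStarProjection Q)
    (h : T = t • P + Q) (ht : 0 ≤ t) {x : ℝ} (hx : x ∈ spectrum ℝ T) : 0 ≤ x :=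
  spectrum_nonneg_of_nonneg (h ▸ add_nonneg (hP.smul_nonneg ht) hQ.nonneg) hx

theorem pencil_spectrum_le (hP : IsStarProjection P) (hQ : IsStarProjection Q)
    (h : T = t • P + Q) (ht : 0 ≤ t) {x : ℝ} (hx : x ∈ spectrum ℝ T) : x ≤ 1 + t := by
  have h1 : (0 : A) ≤ algebraMap ℝ A (1 + t) - T := by
    have e : algebraMap ℝ A (1 + t) - T = t • (1 - P) + (1 - Q) := by
      rw [h, Algebra.algebraMap_eq_smul_one]; module
    rw [e]
    exact add_nonneg (hP.one_sub.smul_nonneg ht) hQ.one_sub.nonneg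
  have h2 : 1 + t - x ∈ spectrum ℝ (algebraMap ℝ A (1 + t) - T) := by
    rw [← spectrum.singleton_sub_eq]
    exact Set.sub_mem_sub rfl hx
  linarith [spectrum_nonneg_of_nonneg h1 h2]

theorem pencil_spectrum_le_one (hP : IsStarProjection P) (hQ : IsStarProjection Q)
    (h : T = t • P + Q) (ht : t ≤ 0) {x : ℝ} (hx : x ∈ spectrum ℝ T) : x ≤ 1 := by
  have h1 : (0 : A) ≤ algebraMap ℝ A 1 - T := by
    have e : algebraMap ℝ A 1 - T = (-t) • P + (1 - Q) := by
      rw [h, Algebra.algebraMap_eq_smul_one]; module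
    rw [e]
    exact add_nonneg (hP.smul_nonneg (by linarith)) hQ.one_sub.nonneg
  have h2 : 1 - x ∈ spectrum ℝ (algebraMap ℝ A 1 - T) := by
    rw [← spectrum.singleton_sub_eq]
    exact Set.sub_mem_sub rfl hx
  linarith [spectrum_nonneg_of_nonneg h1 h2]

/-- For self-adjoint `P, Q` the commutator is skew-adjoint, so `-t² K²` is of the form `star B * B`.
-/
theorem pencilQuartic_eval_nonneg (hP : IsStarProjection P) (hQ : IsStarProjection Q)
    (h : T = t • P + Q) {x : ℝ} (hx : x ∈ spectrum ℝ T) : 0 ≤ (pencilQuartic t).eval x := by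
  have h1 : 0 ≤ Polynomial.aeval T (pencilQuartic t) := by
    have e : Polynomial.aeval T (pencilQuartic t) =
        star (t • (Q * P - P * Q)) * (t • (Q * P - P * Q)) := by
      rw [aeval_pencilQuartic hP.isIdempotentElem hQ.isIdempotentElem h, star_smul, star_sub,
        star_mul, star_mul, hP.isSelfAdjoint.star_eq, hQ.isSelfAdjoint.star_eq,
        smul_mul_smul_comm, ← neg_sub, neg_mul, star_trivial, ← smul_neg, sq]
      simp
    rw [e]
    exact star_mul_self_nonneg _
  exact spectrum_nonneg_of_nonneg h1
    (spectrum.subset_polynomial_aeval T (pencilQuartic t) ⟨x, hx, rfl⟩)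

/-- The spectrum of `t P + Q` avoids the gap between `1` and `t`. -/
theorem pencil_spectrum_gap (hP : IsStarProjection P) (hQ : IsStarProjection Q)
    (h : T = t • P + Q) (ht : 0 ≤ t) {x : ℝ} (hx : x ∈ spectrum ℝ T) :
    x ≤ min 1 t ∨ max 1 t ≤ x := by
  have h0 := pencil_spectrum_nonneg hP hQ h ht hx
  have h1 := pencil_spectrum_le hP hQ h ht hx
  have h2 := pencilQuartic_eval_nonneg hP hQ h hx
  rw [eval_pencilQuartic] at h2
  by_contra! hcon
  obtain ⟨h3, h4⟩ := hcon
  rcases le_total 1 t with h5 | h5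
  · rw [min_eq_left h5] at h3
    rw [max_eq_right h5] at h4
    have : 0 < x * (1 + t - x) * (x - 1) * (t - x) := by
      have : 0 < 1 + t - x := by linarith
      have := sub_pos.2 h3
      have := sub_pos.2 h4
      positivity
    linarith
  · rw [min_eq_right h5] at h3
    rw [max_eq_left h5] at h4
    have : 0 < x * (1 + t - x) * (1 - x) * (x - t) := by
      have : 0 < 1 + t - x := by linarith
      have := sub_pos.2 h3
      have := sub_pos.2 h4
      have : 0 < x := by linarith
      positivity
    linarith

/-- An operator that is a pencil at `t` and at `2 t` has spectrum in the four exceptional points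
of the first pencil. -/
theorem spectrum_subset_of_pencil_pencil {P' Q' : A} (hP : IsStarProjection P)
    (hQ : IsStarProjection Q) (h : T = t • P + Q) (hP' : IsStarProjection P')
    (hQ' : IsStarProjection Q') (h' : T = (2 * t) • P' + Q') (ht : 0 < t) (ht1 : t ≠ 1)
    {x : ℝ} (hx : x ∈ spectrum ℝ T) : x = 0 ∨ x = 1 ∨ t < 1 ∧ (x = t ∨ x = 1 + t) := by
  -- The second reflection sends `y` to `1 + 2t - y > 1 + t`, beyond the upper bound from the first
  -- pencil.
  have low : ∀ y ∈ spectrum ℝ T, 0 < y → y < min 1 t → False := by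
    intro y hy hy0 hy1
    have a1 := lt_of_lt_of_le hy1 (min_le_left _ _)
    have a2 := lt_of_lt_of_le hy1 (min_le_right _ _)
    have := pencil_spectrum_symm_of_ne hP'.isIdempotentElem hQ'.isIdempotentElem h'
      hy hy0.ne' a1.ne (by linarith) (by linarith)
    have := pencil_spectrum_le hP hQ h ht.le this
    linarith
  -- The first reflection sends this interval to the one just excluded.
  have high : ∀ y ∈ spectrum ℝ T, max 1 t < y → y < 1 + t → False := by
    intro y hy hy0 hy1
    have a1 := lt_of_le_of_lt (le_max_left _ _) hy0
    have a2 := lt_of_le_of_lt (le_max_right _ _) hy0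
    have := pencil_spectrum_symm_of_ne hP.isIdempotentElem hQ.isIdempotentElem h
      hy (by linarith) a1.ne' a2.ne' hy1.ne
    exact low _ this (by linarith) (lt_min (by linarith) (by linarith))
  have h0 := pencil_spectrum_nonneg hP hQ h ht.le hx
  have h1 := pencil_spectrum_le hP hQ h ht.le hx
  rcases lt_or_gt_of_ne ht1 with ht1 | ht1
  · have low := low x hx
    have high := high x hx
    have gap := pencil_spectrum_gap hP hQ h ht.le hx
    rw [min_eq_right ht1.le] at low gap
    rw [max_eq_left ht1.le] at high gap
    grind
  · have low := low x hx
    have high := high x hx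
    have gap := pencil_spectrum_gap hP hQ h ht.le hx
    -- For `t > 1` both `t` and `1 + t` lie strictly between `1` and `2t`, so the gap of the second
    -- pencil removes them.
    have gap' := pencil_spectrum_gap hP' hQ' h' (by linarith) hx
    rw [min_eq_left (by linarith)] at low gap gap'
    rw [max_eq_right (by linarith)] at high gap gap'
    grind

/-- If the spectrum of `T` contains `z` and `1 + z` and is contained in `{0, 1, z, 1 + z}`, where
`0 < z < 1`, then `T` is a pencil at `z` and `2 z` at most. -/
theorem eq_or_eq_two_mul_of_pencil {z : ℝ} (hz0 : 0 < z) (hz1 : z < 1)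
    (hz : z ∈ spectrum ℝ T) (hz' : 1 + z ∈ spectrum ℝ T)
    (hs : ∀ x ∈ spectrum ℝ T, x = 0 ∨ x = 1 ∨ x = 1 + z ∨ x = z)
    (hP : IsStarProjection P) (hQ : IsStarProjection Q) (h : T = t • P + Q) :
    t = z ∨ t = 2 * z := by
  have ht : 0 < t := by
    by_contra! ht
    linarith [pencil_spectrum_le_one hP hQ h ht hz']
  by_cases h1 : z = t
  · exact .inl h1.symm
  have h2 := hs _ (pencil_spectrum_symm_of_ne hP.isIdempotentElem hQ.isIdempotentElem h
    hz hz0.ne' hz1.ne h1 (by linarith))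
  -- Among the possible values of `1 + t - z`, the value `1 + z` gives `t = 2z`; the value `z` would
  -- give `t = 2z - 1 < z`, but the gap forces `z ≤ t`.
  have h3 := pencil_spectrum_gap hP hQ h ht.le hz
  grind

end Order

/-! ### Hilbert dimension and isometric isomorphism. -/

section HilbertDim

theorem hilbertDim_eq_iff {E F : Type u} [NormedAddCommGroup E] [InnerProductSpace ℂ E]
    [CompleteSpace E] [NormedAddCommGroup F] [InnerProductSpace ℂ F] [CompleteSpace F] :
    hilbertDim E = hilbertDim F ↔ Nonempty (E ≃ₗᵢ[ℂ] F) := by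
  obtain ⟨s, b, -⟩ := exists_hilbertBasis ℂ E
  obtain ⟨s', c, -⟩ := exists_hilbertBasis ℂ F
  constructor
  · rw [hilbertDim_eq b, hilbertDim_eq c, Cardinal.eq]
    rintro ⟨e⟩
    have hc := c.orthonormal.comp e e.injective
    let c' := HilbertBasis.mk hc (by
      rw [e.surjective.range_comp, c.dense_span])
    exact ⟨b.repr.trans c'.repr.symm⟩
  · rintro ⟨e⟩
    rw [hilbertDim_eq b, hilbertDim_eq (HilbertBasis.ofRepr (e.symm.trans b.repr))]

variable {H : Type*} [NormedAddCommGroup H] [InnerProductSpace ℂ H]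

theorem nonempty_linearIsometryEquiv_of_mapsTo {M N : Submodule ℂ H} (S : H →L[ℂ] H)
    (hS : ∀ v ∈ M, S v ∈ N) (hn : ∀ v ∈ M, ‖S v‖ = ‖v‖) (hsurj : ∀ w ∈ N, ∃ v ∈ M, S v = w) :
    Nonempty (M ≃ₗᵢ[ℂ] N) := by
  let f : M →ₗᵢ[ℂ] N := ⟨(S : H →ₗ[ℂ] H).restrict hS, fun v => hn v v.2⟩
  refine ⟨LinearIsometryEquiv.ofSurjective f fun w => ?_⟩
  obtain ⟨v, hv, h⟩ := hsurj w w.2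
  exact ⟨⟨v, hv⟩, Subtype.ext h⟩

end HilbertDim

/-! ### The commutator as an isometry between eigenspaces. -/

section Eigenspaces

variable {H : Type*} [NormedAddCommGroup H] [InnerProductSpace ℂ H]

theorem mem_ker_sub_smul_one {T : H →L[ℂ] H} {x : ℝ} {v : H} :
    v ∈ (T - (x : ℂ) • (1 : H →L[ℂ] H)).ker ↔ T v = x • v := by
  simp [LinearMap.mem_ker, sub_eq_zero]

variable {P Q T : H →L[ℂ] H} {t : ℝ}

theorem aeval_pencilQuartic_apply {x : ℝ} {v : H} (hv : T v = x • v) :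
    Polynomial.aeval T (pencilQuartic t) v = (pencilQuartic t).eval x • v := by
  rw [eval_pencilQuartic]
  simp only [pencilQuartic, map_mul, map_sub, Polynomial.aeval_X, Polynomial.aeval_C, map_one,
    Algebra.algebraMap_eq_smul_one, mul_apply_eq_comp, sub_apply,
    smul_apply, one_apply_eq_self, hv, ContinuousLinearMap.map_smul_of_tower]
  module

variable [CompleteSpace H]

/-- On both eigenspaces `t² [Q, P]²` acts as the scalar `-f_t(x)`, since `f_t` is invariant under
the reflection. Dividing `t [Q, P]` by `√(f_t(x))` gives a skew-adjoint operator with square `-1`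
there, hence isometric, with inverse its negative. -/
theorem hilbertDim_ker_pencil_symm (hP : IsStarProjection P) (hQ : IsStarProjection Q)
    (h : T = t • P + Q) {x : ℝ} (hx : 0 < (pencilQuartic t).eval x) :
    hilbertDim (T - (x : ℂ) • (1 : H →L[ℂ] H)).ker =
      hilbertDim (T - ((1 + t - x : ℝ) : ℂ) • (1 : H →L[ℂ] H)).ker := by
  have hc1 : CompleteSpace (T - (x : ℂ) • (1 : H →L[ℂ] H)).ker :=
    (ContinuousLinearMap.isClosed_ker _).completeSpace_coe
  have hc2 : CompleteSpace (T - ((1 + t - x : ℝ) : ℂ) • (1 : H →L[ℂ] H)).ker :=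
    (ContinuousLinearMap.isClosed_ker _).completeSpace_coe
  rw [hilbertDim_eq_iff]
  set c := (pencilQuartic t).eval x with hc
  set K := (t / √c) • (Q * P - P * Q) with hK
  have hsymm : (pencilQuartic t).eval (1 + t - x) = c := by
    rw [hc, eval_pencilQuartic, eval_pencilQuartic]; ring
  have hmap : ∀ y v, T v = y • v → T (K v) = (1 + t - y) • K v := by
    intro y v hv
    have e : T * K = K * ((1 + t) • 1 - T) := by
      rw [hK, mul_smul_comm, pencil_mul_commutator hP.isIdempotentElem hQ.isIdempotentElem h,
        smul_mul_assoc]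
    have e' := congrArg (fun S : H →L[ℂ] H => S v) e
    simp only [mul_apply_eq_comp, sub_apply, smul_apply,
      one_apply_eq_self, hv, map_sub, ContinuousLinearMap.map_smul_of_tower] at e'
    rw [e', ← sub_smul]
  have hKK : ∀ y v, (pencilQuartic t).eval y = c → T v = y • v → K (K v) = -v := by
    intro y v hy hv
    have e : K * K = -(c⁻¹ • Polynomial.aeval T (pencilQuartic t)) := by
      rw [aeval_pencilQuartic hP.isIdempotentElem hQ.isIdempotentElem h, hK, smul_mul_smul_comm,
        div_mul_div_comm, Real.mul_self_sqrt hx.le, smul_neg, neg_neg, smul_smul]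
      congr 1
      ring
    have e' := congrArg (fun S : H →L[ℂ] H => S v) e
    simp only [mul_apply_eq_comp, neg_apply, smul_apply,
      aeval_pencilQuartic_apply hv, hy] at e'
    rw [e', inv_smul_smul₀ hx.ne']
  have hKs : star K = -K := by
    rw [hK, star_smul, star_sub, star_mul, star_mul, hP.isSelfAdjoint.star_eq,
      hQ.isSelfAdjoint.star_eq, star_trivial, ← smul_neg, neg_sub]
  refine nonempty_linearIsometryEquiv_of_mapsTo K ?_ ?_ ?_
  · intro v hv
    rw [mem_ker_sub_smul_one] at hv ⊢
    exact hmap x v hv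
  · intro v hv
    rw [mem_ker_sub_smul_one] at hv
    have : ⟪K v, K v⟫_ℂ = ⟪v, v⟫_ℂ := by
      rw [← ContinuousLinearMap.adjoint_inner_left, ← ContinuousLinearMap.star_eq_adjoint, hKs,
        neg_apply, hKK x v rfl hv, neg_neg]
    rw [inner_self_eq_norm_sq_to_K, inner_self_eq_norm_sq_to_K] at this
    have h2 : ‖K v‖ ^ 2 = ‖v‖ ^ 2 := by exact_mod_cast this
    exact (sq_eq_sq₀ (norm_nonneg _) (norm_nonneg _)).1 h2
  · intro w hw
    rw [mem_ker_sub_smul_one] at hw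
    refine ⟨-K w, ?_, ?_⟩
    · rw [mem_ker_sub_smul_one, map_neg, hmap _ w hw]
      simp
    · rw [map_neg, hKK _ w hsymm hw, neg_neg]

end Eigenspaces

/-! ### Passage to the real spectrum. -/

section Restatement

variable {H : Type*} [NormedAddCommGroup H] [InnerProductSpace ℂ H]

theorem pencil_eq (P Q : H →L[ℂ] H) (t : ℝ) : pencil P Q t = t • P + Q := by
  rw [pencil, Complex.coe_smul]

theorem ofReal_mem_spectrum_iff {T : H →L[ℂ] H} {x : ℝ} :
    (x : ℂ) ∈ spectrum ℂ T ↔ x ∈ spectrum ℝ T := by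
  have h : algebraMap ℂ (H →L[ℂ] H) x = algebraMap ℝ (H →L[ℂ] H) x := by
    simp only [Algebra.algebraMap_eq_smul_one, Complex.coe_smul]
  simp only [spectrum.mem_iff, h]

variable [CompleteSpace H] {T : H →L[ℂ] H}

theorem hasShiftedSpectrum_iff (hT : IsSelfAdjoint T) {z : ℝ} :
    HasShiftedSpectrum T z ↔ 1 + z ∈ spectrum ℝ T ∧ z ∈ spectrum ℝ T ∧
      (∀ x ∈ spectrum ℝ T, x = 0 ∨ x = 1 ∨ x = 1 + z ∨ x = z) ∧
      hilbertDim (T - ((1 + z : ℝ) : ℂ) • (1 : H →L[ℂ] H)).ker =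
        hilbertDim (T - (z : ℂ) • (1 : H →L[ℂ] H)).ker := by
  have h1 : (1 + (z : ℂ)) = ((1 + z : ℝ) : ℂ) := by push_cast; rfl
  rw [HasShiftedSpectrum, h1, Set.pair_subset_iff, ofReal_mem_spectrum_iff, ofReal_mem_spectrum_iff,
    and_assoc]
  refine and_congr_right fun _ => and_congr_right fun _ => and_congr_left fun _ => ?_
  constructor
  · intro h x hx
    have := h (ofReal_mem_spectrum_iff.2 hx)
    simp only [Set.mem_insert_iff, Set.mem_singleton_iff] at this
    exact_mod_cast this
  · intro h x hx
    obtain ⟨r, rfl⟩ : ∃ r : ℝ, x = r := ⟨x.re, hT.mem_spectrum_eq_re hx⟩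
    simp only [Set.mem_insert_iff, Set.mem_singleton_iff]
    exact_mod_cast h r (ofReal_mem_spectrum_iff.1 hx)

end Restatement

/-! ### Block projections built from a partial isometry. -/

section Block

variable {A : Type*} [Ring A] [StarRing A] [Algebra ℝ A] {a b V : A}

/-- The operator with matrix `!![p, r; r, q]` with respect to the initial and the final projection
`a`, `b` of the partial isometry `V`. -/
def blockMatrix (a b V : A) (p q r : ℝ) : A := p • a + q • b + r • (V + star V)

theorem blockMatrix_mul {c : A} (hac : a * c = 0) (hbc : b * c = 0) (hVa : V * a = V)
    (hbV : b * V = V) (hb : IsStarProjection b) (p q r : ℝ) : blockMatrix a b V p q r * c = 0 := by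
  have h1 : V * c = 0 := by rw [← hVa, mul_assoc, hac, mul_zero]
  have s3 : star V * b = star V := by
    have := congrArg star hbV
    rwa [star_mul, hb.isSelfAdjoint.star_eq] at this
  have h2 : star V * c = 0 := by rw [← s3, mul_assoc, hbc, mul_zero]
  simp [blockMatrix, add_mul, hac, hbc, h1, h2]

/-- Compression to the corner `a` reads off the entry `p`, which serves to show that the block
projections are nontrivial. -/
theorem mul_blockMatrix_mul (ha : IsStarProjection a)
    (hab : a * b = 0) (hbV : b * V = V) (p q r : ℝ) :
    a * blockMatrix a b V p q r * a = p • a := by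
  have haV : a * V = 0 := by rw [← hbV, ← mul_assoc, hab, zero_mul]
  have s4 : star V * a = 0 := by
    have := congrArg star haV
    rwa [star_mul, ha.isSelfAdjoint.star_eq, star_zero] at this
  simp only [blockMatrix, mul_add, add_mul, mul_smul_comm, smul_mul_assoc, mul_assoc,
    ha.isIdempotentElem.eq, s4, haV, mul_zero, add_zero]
  rw [← mul_assoc, hab, zero_mul, smul_zero, smul_zero, add_zero, add_zero]

variable [StarModule ℝ A]

/-- The elements `a, b, V, star V` multiply like `2 × 2` matrix units, and the three scalar
equations say that `!![p, r; r, q]` is idempotent. -/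
theorem isStarProjection_blockMatrix (ha : IsStarProjection a) (hb : IsStarProjection b)
    (hab : a * b = 0) (hVa : V * a = V) (hbV : b * V = V) (h1 : star V * V = a)
    (h2 : V * star V = b) {p q r : ℝ} (hp : p ^ 2 + r ^ 2 = p) (hq : q ^ 2 + r ^ 2 = q)
    (hr : r * (p + q) = r) : IsStarProjection (blockMatrix a b V p q r) := by
  have hba : b * a = 0 := by
    have := congrArg star hab
    simpa [ha.isSelfAdjoint.star_eq, hb.isSelfAdjoint.star_eq] using this
  have haV : a * V = 0 := by rw [← hbV, ← mul_assoc, hab, zero_mul]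
  have hVb : V * b = 0 := by rw [← hVa, mul_assoc, hab, mul_zero]
  have hVV : V * V = 0 := by
    calc V * V = V * (a * V) := by rw [← mul_assoc, hVa]
      _ = 0 := by rw [haV, mul_zero]
  have s1 : star V * star V = 0 := by rw [← star_mul, hVV, star_zero]
  have s2 : a * star V = star V := by
    have := congrArg star hVa
    rwa [star_mul, ha.isSelfAdjoint.star_eq] at this
  have s3 : star V * b = star V := by
    have := congrArg star hbV
    rwa [star_mul, hb.isSelfAdjoint.star_eq] at this
  have s4 : star V * a = 0 := by
    have := congrArg star haV
    rwa [star_mul, ha.isSelfAdjoint.star_eq, star_zero] at this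
  have s5 : b * star V = 0 := by
    have := congrArg star hVb
    rwa [star_mul, hb.isSelfAdjoint.star_eq, star_zero] at this
  refine ⟨?_, ?_⟩
  · have e : blockMatrix a b V p q r * blockMatrix a b V p q r =
        blockMatrix a b V (p ^ 2 + r ^ 2) (q ^ 2 + r ^ 2) (r * (p + q)) := by
      simp only [blockMatrix, mul_add, add_mul, smul_mul_smul_comm, ha.isIdempotentElem.eq,
        hb.isIdempotentElem.eq, hab, hba, haV, hVb, hVV, hVa, hbV, h1, h2, s1, s2, s3, s4, s5,
        smul_zero, add_zero, zero_add]
      module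
    rw [hp, hq, hr] at e
    exact e
  · rw [isSelfAdjoint_iff]
    simp only [blockMatrix, star_add, star_smul, star_trivial, star_star,
      ha.isSelfAdjoint.star_eq, hb.isSelfAdjoint.star_eq]
    module

/-- The diagonal operator `z a + (1 + z) b + c` is a pencil at `2 z` if `a` and `b` are
equivalent projections. -/
theorem exists_pencil_two_mul {c : A} {z : ℝ} (hz : z ∈ Set.Ioo (0 : ℝ) 1)
    (ha : IsStarProjection a) (hb : IsStarProjection b) (hc : IsStarProjection c)
    (hab : a * b = 0) (hac : a * c = 0) (hbc : b * c = 0)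
    (hVa : V * a = V) (hbV : b * V = V) (h1 : star V * V = a) (h2 : V * star V = b)
    (ha0 : a ≠ 0) :
    ∃ P Q : A, IsStarProjection P ∧ IsStarProjection Q ∧ P ≠ 0 ∧ Q ≠ 0 ∧ Q ≠ 1 ∧
      z • a + (1 + z) • b + c = (2 * z) • P + Q := by
  obtain ⟨hz0, hz1⟩ := hz
  set β := √((1 - z ^ 2) / 4) with hβ
  have hβ2 : β ^ 2 = (1 - z ^ 2) / 4 := Real.sq_sqrt (by nlinarith)
  -- The task is to write `diag(z, 1 + z)` as `2z p + m` with rank-one projections `p, m`. The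
  -- off-diagonal entries must cancel, and `(1 - z)/2, (1 + z)/2` against `z², 1 - z²` give the
  -- right diagonal.
  have hP := isStarProjection_blockMatrix ha hb hab hVa hbV h1 h2
    (p := (1 - z) / 2) (q := (1 + z) / 2) (r := β) (by rw [hβ2]; ring) (by rw [hβ2]; ring) (by ring)
  have hM := isStarProjection_blockMatrix ha hb hab hVa hbV h1 h2
    (p := z ^ 2) (q := 1 - z ^ 2) (r := -(2 * z * β)) (by rw [neg_sq, mul_pow, hβ2]; ring)
    (by rw [neg_sq, mul_pow, hβ2]; ring) (by ring)
  have hQ := hM.add hc (blockMatrix_mul hac hbc hVa hbV hb _ _ _)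
  have hQa : a * (blockMatrix a b V (z ^ 2) (1 - z ^ 2) (-(2 * z * β)) + c) * a = z ^ 2 • a := by
    rw [mul_add, hac, add_zero, mul_blockMatrix_mul ha hab hbV]
  refine ⟨_, _, hP, hQ, ?_, ?_, ?_, ?_⟩
  · intro h
    have := mul_blockMatrix_mul ha hab hbV ((1 - z) / 2) ((1 + z) / 2) β
    rw [h, mul_zero, zero_mul, eq_comm, smul_eq_zero] at this
    rcases this with this | this
    · linarith
    · exact ha0 this
  · intro h
    rw [h, mul_zero, zero_mul, eq_comm, smul_eq_zero] at hQa
    exact hQa.elim (by positivity) ha0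
  · intro h
    rw [h, mul_one, ha.isIdempotentElem.eq] at hQa
    have : (1 - z ^ 2) • a = 0 := by rw [sub_smul, ← hQa, one_smul, sub_self]
    rw [smul_eq_zero] at this
    rcases this with this | this
    · nlinarith
    · exact ha0 this
  · simp only [blockMatrix]
    module

end Block

/-! ### Partial isometries from isometric subspaces. -/

section PartialIsometry

variable {H : Type*} [NormedAddCommGroup H] [InnerProductSpace ℂ H] [CompleteSpace H]

theorem exists_partialIsometry {M N : Submodule ℂ H} [CompleteSpace M] [CompleteSpace N]
    (U : M ≃ₗᵢ[ℂ] N) : ∃ V : H →L[ℂ] H, V * M.starProjection = V ∧ N.starProjection * V = V ∧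
      star V * V = M.starProjection ∧ V * star V = N.starProjection := by
  let u : M →L[ℂ] N := U.toContinuousLinearEquiv
  let w : N →L[ℂ] M := U.symm.toContinuousLinearEquiv
  have hadj : ContinuousLinearMap.adjoint u = w := by
    rw [eq_comm, ContinuousLinearMap.eq_adjoint_iff]
    intro x y
    have := U.inner_map_map (U.symm x) y
    rw [U.apply_symm_apply] at this
    exact this.symm
  have hstar : star (N.subtypeL ∘L u ∘L M.orthogonalProjectionOnto) =
      M.subtypeL ∘L w ∘L N.orthogonalProjectionOnto := by
    rw [ContinuousLinearMap.star_eq_adjoint, ContinuousLinearMap.adjoint_comp,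
      ContinuousLinearMap.adjoint_comp, hadj, Submodule.adjoint_subtypeL,
      Submodule.adjoint_orthogonalProjectionOnto]
    rfl
  refine ⟨N.subtypeL ∘L u ∘L M.orthogonalProjectionOnto, ?_, ?_, ?_, ?_⟩
  · ext v
    simp [u, Submodule.orthogonalProjectionOnto_starProjection_of_le le_rfl]
  · ext v
    simp [u]
  · rw [hstar]
    ext v
    simp [u, w]
  · rw [hstar]
    ext v
    simp [u, w]

end PartialIsometry

/-! ### Spectral projections of an operator with finite spectrum. -/

section SpectralProjection

variable {H : Type*} [NormedAddCommGroup H] [InnerProductSpace ℂ H] [CompleteSpace H]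
  {T : H →L[ℂ] H}

/-- The spectral projection of `T` at a point `x` that is isolated in the spectrum. -/
noncomputable def eigenprojection (T : H →L[ℂ] H) (x : ℝ) : H →L[ℂ] H :=
  cfc (fun y : ℝ => if y = x then (1 : ℝ) else 0) T

theorem isStarProjection_eigenprojection (hfin : (spectrum ℝ T).Finite) (x : ℝ) :
    IsStarProjection (eigenprojection T x) := by
  refine ⟨?_, IsSelfAdjoint.cfc⟩
  rw [IsIdempotentElem, eigenprojection, ← cfc_mul _ _ T (hfin.continuousOn _)
    (hfin.continuousOn _)]
  congr 1
  ext y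
  split_ifs <;> simp

theorem eigenprojection_mul_of_ne (hfin : (spectrum ℝ T).Finite) {x y : ℝ} (hxy : x ≠ y) :
    eigenprojection T x * eigenprojection T y = 0 := by
  rw [eigenprojection, eigenprojection,
    ← cfc_mul _ _ T (hfin.continuousOn _) (hfin.continuousOn _)]
  have : (fun u : ℝ => (if u = x then (1 : ℝ) else 0) * if u = y then (1 : ℝ) else 0) =
      fun _ => 0 := by
    ext u
    grind
  rw [this, cfc_const_zero]

theorem eigenprojection_ne_zero (hT : IsSelfAdjoint T) (hfin : (spectrum ℝ T).Finite) {x : ℝ}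
    (hx : x ∈ spectrum ℝ T) : eigenprojection T x ≠ 0 := by
  intro h
  have h1 : (1 : ℝ) ∈ spectrum ℝ (eigenprojection T x) := by
    rw [eigenprojection, cfc_map_spectrum _ T hT (hfin.continuousOn _)]
    exact ⟨x, hx, if_pos rfl⟩
  rw [h, spectrum.mem_iff, sub_zero] at h1
  exact h1 (by simp)

theorem eigenprojection_eq_starProjection (hT : IsSelfAdjoint T) (hfin : (spectrum ℝ T).Finite)
    (x : ℝ) [CompleteSpace (T - (x : ℂ) • (1 : H →L[ℂ] H)).ker] :
    eigenprojection T x = (T - (x : ℂ) • (1 : H →L[ℂ] H)).ker.starProjection := by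
  have hc : ∀ f : ℝ → ℝ, ContinuousOn f (spectrum ℝ T) := fun f => hfin.continuousOn f
  have hTx : cfc (fun y : ℝ => y - x) T = T - (x : ℂ) • (1 : H →L[ℂ] H) := by
    rw [cfc_sub _ _ T (hc _) (hc _), cfc_id' ℝ T hT, cfc_const x T hT,
      Algebra.algebraMap_eq_smul_one, Complex.coe_smul]
  have h1 : (T - (x : ℂ) • (1 : H →L[ℂ] H)) * eigenprojection T x = 0 := by
    rw [← hTx, eigenprojection, ← cfc_mul _ _ T (hc _) (hc _)]
    have : (fun u : ℝ => (u - x) * if u = x then (1 : ℝ) else 0) = fun _ => 0 := by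
      ext u
      grind
    rw [this, cfc_const_zero]
  -- Since `0⁻¹ = 0`, the product `(y - x)⁻¹ (y - x)` is the indicator of `y ≠ x`. The identity
  -- shows that `eigenprojection T x` fixes the kernel.
  have h2 : cfc (fun y : ℝ => (y - x)⁻¹) T * (T - (x : ℂ) • (1 : H →L[ℂ] H)) =
      1 - eigenprojection T x := by
    rw [← hTx, eigenprojection, ← cfc_mul _ _ T (hc _) (hc _), ← cfc_one ℝ T hT,
      ← cfc_sub _ _ T (hc _) (hc _)]
    congr 1
    ext u
    by_cases hu : u = x
    · simp [hu]
    · simp [hu, inv_mul_cancel₀ (sub_ne_zero.2 hu)]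
  ext v
  refine (Submodule.eq_starProjection_of_mem_of_inner_eq_zero ?_ fun w hw => ?_).symm
  · exact congrArg (fun S : H →L[ℂ] H => S v) h1
  · have hw' : w - eigenprojection T x w = 0 := by
      have := congrArg (fun S : H →L[ℂ] H => S w) h2
      simp only [mul_apply_eq_comp] at this
      rw [show (T - (x : ℂ) • (1 : H →L[ℂ] H)) w = 0 from hw, map_zero] at this
      exact this.symm
    have hsa : IsSelfAdjoint (eigenprojection T x) := IsSelfAdjoint.cfc
    rw [inner_sub_left, ← ContinuousLinearMap.adjoint_inner_right,
      ← ContinuousLinearMap.star_eq_adjoint, hsa.star_eq, ← inner_sub_right, hw', inner_zero_right]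

/-- The set `s` may exceed the spectrum, which allows for `0` and `1` being absent from it. -/
theorem eq_sum_eigenprojection (hT : IsSelfAdjoint T) {s : Finset ℝ}
    (hs : spectrum ℝ T ⊆ s) : T = ∑ x ∈ s, x • eigenprojection T x := by
  have hfin : (spectrum ℝ T).Finite := s.finite_toSet.subset hs
  have hc : ∀ f : ℝ → ℝ, ContinuousOn f (spectrum ℝ T) := fun f => hfin.continuousOn f
  simp only [eigenprojection]
  conv_lhs => rw [← cfc_id' ℝ T hT]
  simp only [← cfc_smul _ _ T (hc _)]
  rw [← cfc_sum _ T s fun i _ => hc _]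
  refine cfc_congr fun y hy => ?_
  have : y ∈ s := hs hy
  simp [this]

end SpectralProjection

/-! ### Equivalence of the double pencil and the spectral condition. -/

section ShiftedSpectrum

variable {H : Type*} [NormedAddCommGroup H] [InnerProductSpace ℂ H] [CompleteSpace H]
  {T : H →L[ℂ] H} {z : ℝ}

/-- The map `x ↦ 1 - x` sends `z` to `1 + (-z)` and `1 + z` to `-z`, so the two eigenspaces trade
roles. -/
theorem HasShiftedSpectrum.one_sub (hT : IsSelfAdjoint T) (h : HasShiftedSpectrum T z) :
    HasShiftedSpectrum (1 - T) (-z) := by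
  rw [hasShiftedSpectrum_iff hT] at h
  rw [hasShiftedSpectrum_iff ((IsSelfAdjoint.one _).sub hT)]
  obtain ⟨h1, h2, h3, h4⟩ := h
  have key : ∀ x, x ∈ spectrum ℝ (1 - T) ↔ 1 - x ∈ spectrum ℝ T := by
    intro x
    rw [← map_one (algebraMap ℝ (H →L[ℂ] H)), ← spectrum.singleton_sub_eq, Set.singleton_sub,
      Set.mem_image]
    constructor
    · rintro ⟨y, hy, rfl⟩
      rwa [sub_sub_cancel]
    · exact fun hx => ⟨_, hx, sub_sub_cancel _ _⟩
  have hker : ∀ x y : ℝ, x + y = 1 → (1 - T - (x : ℂ) • (1 : H →L[ℂ] H)).ker =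
      (T - (y : ℂ) • (1 : H →L[ℂ] H)).ker := by
    intro x y hxy
    ext v
    obtain rfl : x = 1 - y := by linarith
    rw [mem_ker_sub_smul_one, mem_ker_sub_smul_one, sub_apply, one_apply_eq_self, sub_smul,
      one_smul, sub_right_inj]
  refine ⟨?_, ?_, ?_, ?_⟩
  · rw [key]; simpa using h2
  · rw [key]; simpa using h1
  · intro x hx
    have := h3 _ ((key x).1 hx)
    grind
  · rw [hker (1 + -z) z (by ring), hker (-z) (1 + z) (by ring), h4]

/-- The extra conclusion `Q ≠ 1` keeps `1 - Q` nonzero when the result is transferred from `1 - T`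
to `T`. -/
theorem HasShiftedSpectrum.exists_pencil (hT : IsSelfAdjoint T) (h : HasShiftedSpectrum T z)
    (hz : z ∈ Set.Ioo (0 : ℝ) 1) {t : ℝ} (ht : t = z ∨ t = 2 * z) :
    ∃ P Q : H →L[ℂ] H, IsStarProjection P ∧ IsStarProjection Q ∧ P ≠ 0 ∧ Q ≠ 0 ∧ Q ≠ 1 ∧
      T = t • P + Q := by
  rw [hasShiftedSpectrum_iff hT] at h
  obtain ⟨h1, h2, h3, h4⟩ := h
  obtain ⟨hz0, hz1⟩ := hz
  have hs : spectrum ℝ T ⊆ ({0, 1, 1 + z, z} : Finset ℝ) := by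
    intro x hx
    simpa using h3 x hx
  have hfin : (spectrum ℝ T).Finite := (Finset.finite_toSet _).subset hs
  have hsum : T = z • eigenprojection T z + (1 + z) • eigenprojection T (1 + z) +
      eigenprojection T 1 := by
    conv_lhs => rw [eq_sum_eigenprojection hT hs]
    rw [Finset.sum_insert (by simp; grind), Finset.sum_insert (by simp; grind),
      Finset.sum_insert (by simp), Finset.sum_singleton]
    module
  have ha := isStarProjection_eigenprojection hfin z
  have hb := isStarProjection_eigenprojection hfin (1 + z)
  have hc := isStarProjection_eigenprojection hfin 1
  have hab := eigenprojection_mul_of_ne hfin (show z ≠ 1 + z by linarith)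
  have hac := eigenprojection_mul_of_ne hfin hz1.ne
  have hbc := eigenprojection_mul_of_ne hfin (show 1 + z ≠ 1 by linarith)
  have ha0 := eigenprojection_ne_zero hT hfin h2
  have hb0 := eigenprojection_ne_zero hT hfin h1
  rcases ht with rfl | rfl
  -- At the parameter `z` the projections are `a + b` and `b + c`; equality of dimensions plays no
  -- role here.
  · have hP := ha.add hb hab
    have hQ := hb.add hc hbc
    refine ⟨_, _, hP, hQ, ?_, ?_, ?_, ?_⟩
    · intro h
      have := congrArg (eigenprojection T t * ·) h
      simp only [mul_add, ha.isIdempotentElem.eq, hab, add_zero, mul_zero] at this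
      exact ha0 this
    · intro h
      have := congrArg (eigenprojection T (1 + t) * ·) h
      simp only [mul_add, hb.isIdempotentElem.eq, hbc, add_zero, mul_zero] at this
      exact hb0 this
    · intro h
      have := congrArg (eigenprojection T t * ·) h
      simp only [mul_add, hab, hac, add_zero, mul_one] at this
      exact ha0 this.symm
    · conv_lhs => rw [hsum]
      module
  · have hc1 : CompleteSpace (T - (z : ℂ) • (1 : H →L[ℂ] H)).ker :=
      (ContinuousLinearMap.isClosed_ker _).completeSpace_coe
    have hc2 : CompleteSpace (T - ((1 + z : ℝ) : ℂ) • (1 : H →L[ℂ] H)).ker :=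
      (ContinuousLinearMap.isClosed_ker _).completeSpace_coe
    obtain ⟨U⟩ := hilbertDim_eq_iff.1 h4.symm
    obtain ⟨V, hVa, hbV, hV1, hV2⟩ := exists_partialIsometry U
    rw [← eigenprojection_eq_starProjection hT hfin] at hVa hV1 hbV hV2
    obtain ⟨P, Q, hP, hQ, hP0, hQ0, hQ1, h⟩ :=
      exists_pencil_two_mul ⟨hz0, hz1⟩ ha hb hc hab hac hbc hVa hbV hV1 hV2 ha0
    exact ⟨P, Q, hP, hQ, hP0, hQ0, hQ1, hsum.trans h⟩

theorem hasShiftedSpectrum_of_pencil_pencil (hT : IsSelfAdjoint T) {P Q P' Q' : H →L[ℂ] H} {t : ℝ}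
    (hP : IsStarProjection P) (hQ : IsStarProjection Q) (h : T = t • P + Q)
    (hP' : IsStarProjection P') (hQ' : IsStarProjection Q') (h' : T = (2 * t) • P' + Q')
    (hP0 : P ≠ 0) (ht0 : 0 < t) (ht1 : t ≠ 1) : t < 1 ∧ HasShiftedSpectrum T t := by
  have hsub := fun x => spectrum_subset_of_pencil_pencil hP hQ h hP' hQ' h' ht0 ht1 (x := x)
  -- Otherwise `T` equals its spectral projection at `1`, and an idempotent pencil has `P = 0`.
  have hex : ∃ x ∈ spectrum ℝ T, x ≠ 0 ∧ x ≠ 1 := by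
    by_contra! hcon
    refine hP0 (eq_zero_of_isIdempotentElem_pencil hP.isIdempotentElem hQ.isIdempotentElem h ?_
      ht0.ne' ht1 (by linarith))
    have hs : spectrum ℝ T ⊆ ({0, 1} : Finset ℝ) := by
      intro x hx
      have := hcon x hx
      simp only [Finset.coe_insert, Finset.coe_singleton, Set.mem_insert_iff,
        Set.mem_singleton_iff]
      tauto
    have hsum := eq_sum_eigenprojection hT hs
    rw [Finset.sum_pair zero_ne_one, zero_smul, one_smul, zero_add] at hsum
    rw [hsum]
    exact (isStarProjection_eigenprojection ((Finset.finite_toSet _).subset hs) 1).isIdempotentElem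
  obtain ⟨x, hx, hx0, hx1⟩ := hex
  obtain ⟨ht, hxt⟩ : t < 1 ∧ (x = t ∨ x = 1 + t) := by
    have := hsub x hx
    tauto
  -- The reflection of the pencil at `2t` exchanges `t` and `1 + t`, neither of which is exceptional
  -- for it.
  have hsymm : ∀ y ∈ spectrum ℝ T, y = t ∨ y = 1 + t → 1 + 2 * t - y ∈ spectrum ℝ T :=
    fun y hy hyt => pencil_spectrum_symm_of_ne hP'.isIdempotentElem hQ'.isIdempotentElem h' hy
      (by grind) (by grind) (by grind) (by grind)
  have hmem : 1 + t ∈ spectrum ℝ T ∧ t ∈ spectrum ℝ T := by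
    have := hsymm x hx hxt
    rcases hxt with rfl | rfl
    · exact ⟨by convert this using 1; ring, hx⟩
    · exact ⟨hx, by convert this using 1; ring⟩
  refine ⟨ht, (hasShiftedSpectrum_iff hT).2 ⟨hmem.1, hmem.2, fun y hy => ?_, ?_⟩⟩
  · have := hsub y hy
    tauto
  · have hpos : 0 < (pencilQuartic (2 * t)).eval t := by
      rw [eval_pencilQuartic,
        show t * (1 + 2 * t - t) * (t - 1) * (t - 2 * t) = t ^ 2 * (1 + t) * (1 - t) by ring]
      have := sub_pos.2 ht
      positivity
    rw [hilbertDim_ker_pencil_symm hP' hQ' h' hpos, show 1 + 2 * t - t = 1 + t by ring]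

/-- Complementation turns a pencil at `t` into a pencil at `-t`. -/
theorem one_sub_pencil {A : Type*} [Ring A] [Algebra ℝ A] {P Q T : A} {t : ℝ}
    (h : T = t • P + Q) : 1 - T = (-t) • P + (1 - Q) := by
  rw [h]; module

theorem HasShiftedSpectrum.setOf_isPencilAt (hT : IsSelfAdjoint T) (h : HasShiftedSpectrum T z)
    (hz : z ∈ Set.Ioo (0 : ℝ) 1 ∪ Set.Ioo (-1 : ℝ) 0) :
    {t : ℝ | IsPencilAt T t} = {z, 2 * z} := by
  have uniq : ∀ {S : H →L[ℂ] H} {w t : ℝ} {P Q : H →L[ℂ] H}, IsSelfAdjoint S →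
      HasShiftedSpectrum S w → w ∈ Set.Ioo (0 : ℝ) 1 → IsStarProjection P → IsStarProjection Q →
      S = t • P + Q → t = w ∨ t = 2 * w := by
    intro S w t P Q hS hw hw01 hP hQ h
    obtain ⟨h1, h2, h3, -⟩ := (hasShiftedSpectrum_iff hS).1 hw
    exact eq_or_eq_two_mul_of_pencil hw01.1 hw01.2 h2 h1 h3 hP hQ h
  ext t
  simp only [Set.mem_ofPred_eq, Set.mem_insert_iff, Set.mem_singleton_iff, IsPencilAt, pencil_eq]
  rcases hz with hz | hz
  · constructor
    · rintro ⟨P, Q, hP, hQ, -, -, he⟩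
      exact uniq hT h hz hP hQ he
    · intro ht
      obtain ⟨P, Q, hP, hQ, hP0, hQ0, -, he⟩ := h.exists_pencil hT hz ht
      exact ⟨P, Q, hP, hQ, hP0, hQ0, he⟩
  · have hT' : IsSelfAdjoint (1 - T) := (IsSelfAdjoint.one _).sub hT
    have hz' : -z ∈ Set.Ioo (0 : ℝ) 1 := ⟨by linarith [hz.2], by linarith [hz.1]⟩
    constructor
    · rintro ⟨P, Q, hP, hQ, -, -, he⟩
      have := uniq hT' (h.one_sub hT) hz' hP hQ.one_sub (one_sub_pencil he)
      grind
    · intro ht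
      obtain ⟨P, Q, hP, hQ, hP0, hQ0, hQ1, he⟩ :=
        (h.one_sub hT).exists_pencil hT' hz' (t := -t) (by grind)
      refine ⟨P, 1 - Q, hP, hQ.one_sub, hP0, sub_ne_zero.2 (Ne.symm hQ1), ?_⟩
      have := one_sub_pencil he
      rwa [sub_sub_cancel, neg_neg] at this

end ShiftedSpectrum

/-! ### The main theorem. -/

theorem proposition3p3 {H : Type*} [NormedAddCommGroup H] [InnerProductSpace ℂ H]
    [CompleteSpace H] (T : H →L[ℂ] H) (hT : IsSelfAdjoint T) :
    ((∃ l m : ℝ, l ≠ 0 ∧ m ≠ 0 ∧ max l m = 2 * min l m ∧ 2 * min l m ≠ 2 ∧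
        IsPencilAt T l ∧ IsPencilAt T m) ↔
      ∃ z ∈ Set.Ioo (0 : ℝ) 1, HasShiftedSpectrum T z) ∧
    ((∃ l m : ℝ, l ≠ 0 ∧ m ≠ 0 ∧ min l m = 2 * max l m ∧ 2 * max l m ≠ -2 ∧
        IsPencilAt T l ∧ IsPencilAt T m) ↔
      ∃ z ∈ Set.Ioo (-1 : ℝ) 0, HasShiftedSpectrum T z) ∧
    (∀ z ∈ Set.Ioo (0 : ℝ) 1 ∪ Set.Ioo (-1 : ℝ) 0, HasShiftedSpectrum T z →
      {t : ℝ | IsPencilAt T t} = {z, 2 * z} ∧ {t : ℝ | IsPencilAt T t}.ncard = 2) := by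
  have back : ∀ z ∈ Set.Ioo (0 : ℝ) 1 ∪ Set.Ioo (-1 : ℝ) 0, HasShiftedSpectrum T z →
      IsPencilAt T z ∧ IsPencilAt T (2 * z) := fun z hz h => by
    have := h.setOf_isPencilAt hT hz
    exact ⟨this.ge (by simp), this.ge (by simp)⟩
  -- From `l ≤ 2l` and `l ≠ 0` one gets `l > 0`, and `2l ≠ 2` removes the degenerate parameter `1`.
  have ordered_pos : ∀ l m : ℝ, l ≤ m → l ≠ 0 → m = 2 * l → 2 * l ≠ 2 → IsPencilAt T l →
      IsPencilAt T m → ∃ z ∈ Set.Ioo (0 : ℝ) 1, HasShiftedSpectrum T z := by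
    rintro l m hlm h0 rfl h2 ⟨P, Q, hP, hQ, hP0, -, he⟩ ⟨P', Q', hP', hQ', -, -, he'⟩
    rw [pencil_eq] at he he'
    have hl : 0 < l := lt_of_le_of_ne (by linarith) h0.symm
    obtain ⟨h1, h⟩ := hasShiftedSpectrum_of_pencil_pencil hT hP hQ he hP' hQ' he' hP0 hl
      (by rintro rfl; norm_num at h2)
    exact ⟨l, ⟨hl, h1⟩, h⟩
  have ordered_neg : ∀ l m : ℝ, m ≤ l → l ≠ 0 → m = 2 * l → 2 * l ≠ -2 → IsPencilAt T l →
      IsPencilAt T m → ∃ z ∈ Set.Ioo (-1 : ℝ) 0, HasShiftedSpectrum T z := by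
    rintro l m hlm h0 rfl h2 ⟨P, Q, hP, hQ, hP0, -, he⟩ ⟨P', Q', hP', hQ', -, -, he'⟩
    rw [pencil_eq] at he he'
    have hl : l < 0 := lt_of_le_of_ne (by linarith) h0
    have hT' : IsSelfAdjoint (1 - T) := (IsSelfAdjoint.one _).sub hT
    -- Complementation turns the parameters `l, 2l` into `-l, 2(-l)`, which reduces to the positive
    -- case.
    have he2 := one_sub_pencil he'
    rw [← mul_neg] at he2
    obtain ⟨h1, h⟩ := hasShiftedSpectrum_of_pencil_pencil hT' hP hQ.one_sub (one_sub_pencil he)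
      hP' hQ'.one_sub he2 hP0 (neg_pos.2 hl) (by intro h; exact h2 (by linarith))
    have := h.one_sub hT'
    rw [sub_sub_cancel, neg_neg] at this
    exact ⟨l, ⟨by linarith, hl⟩, this⟩
  refine ⟨⟨?_, ?_⟩, ⟨?_, ?_⟩, ?_⟩
  · rintro ⟨l, m, hl, hm, h, h2, hpl, hpm⟩
    rcases le_total l m with hlm | hlm
    · rw [max_eq_right hlm, min_eq_left hlm] at h
      rw [min_eq_left hlm] at h2
      exact ordered_pos l m hlm hl h h2 hpl hpm
    · rw [max_eq_left hlm, min_eq_right hlm] at h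
      rw [min_eq_right hlm] at h2
      exact ordered_pos m l hlm hm h h2 hpm hpl
  · rintro ⟨z, hz, h⟩
    obtain ⟨h1, h2⟩ := back z (.inl hz) h
    have hmin : min z (2 * z) = z := min_eq_left (by linarith [hz.1])
    have hmax : max z (2 * z) = 2 * z := max_eq_right (by linarith [hz.1])
    exact ⟨z, 2 * z, hz.1.ne', by linarith [hz.1], by rw [hmin, hmax],
      by rw [hmin]; linarith [hz.2], h1, h2⟩
  · rintro ⟨l, m, hl, hm, h, h2, hpl, hpm⟩
    rcases le_total l m with hlm | hlm
    · rw [max_eq_right hlm, min_eq_left hlm] at h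
      rw [max_eq_right hlm] at h2
      exact ordered_neg m l hlm hm h h2 hpm hpl
    · rw [max_eq_left hlm, min_eq_right hlm] at h
      rw [max_eq_left hlm] at h2
      exact ordered_neg l m hlm hl h h2 hpl hpm
  · rintro ⟨z, hz, h⟩
    obtain ⟨h1, h2⟩ := back z (.inr hz) h
    have hmax : max z (2 * z) = z := max_eq_left (by linarith [hz.2])
    have hmin : min z (2 * z) = 2 * z := min_eq_right (by linarith [hz.2])
    refine ⟨z, 2 * z, hz.2.ne, ?_, by rw [hmin, hmax], ?_, h1, h2⟩
    · intro h0; linarith [hz.2]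
    · rw [hmax]; intro h0; linarith [hz.1]
  · intro z hz h
    have := h.setOf_isPencilAt hT hz
    refine ⟨this, ?_⟩
    rw [this, Set.ncard_pair]
    rcases hz with hz | hz <;> intro h0 <;> linarith [hz.1, hz.2]
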